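/- Let $1\le m<n$ be integers, let $E\subset\mathbb R^n$ be non-empty and compact, and let $0\le s\le m$. For $r>0$ let $$\phi_r^s(x)=\min\{1,(r/|x|)^s\}\quad(x\in\mathbb R^n\setminus\{0\}),\qquad \phi_r^s(0)=1,$$ and define the capacity $C_r^s(E)$ by $$\frac1{C_r^s(E)}=\inf_{\mu}\iint\phi_r^s(x-y)\,d\mu(x)\,d\mu(y),$$ the infimum being over all Borel probability measures $\mu$ supported by $E$. The lower and upper $s$-box dimension profiles of $E$ are $$\underline{\dim}_B^s E=\liminf_{r\to0^+}\frac{\log C_r^s(E)}{-\log r},\qquad \overline{\dim}_B^s E=\limsup_{r\to0^+}\frac{\log C_r^s(E)}{-\log r}.$$ For a non-empty bounded set $F$ let $N_r(F)$ be the least number of sets of diameter at most $r$ that cover $F$, and let $$\underline{\dim}_B F=\liminf_{r\to0^+}\frac{\log N_r(F)}{-\log r},\qquad \overline{\dim}_B F=\limsup_{r\to0^+}\frac{\log N_r(F)}{-\log r}$$ be its lower and upper box-counting dimensions. Let $G(n,m)$ be the set of $m$-dimensional linear subspaces of $\mathbb R^n$, with the metric $d(V,W)=\|\pi_V-\pi_W\|$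 (operator norm), where $\pi_V$ is the orthogonal projection onto $V$; let $\dim_H$ denote Hausdorff dimension with respect to this metric, with $\dim_H\emptyset=0$. Then $$\dim_H\{V\in G(n,m):\overline{\dim}_B\,\pi_V E<\overline{\dim}_B^s E\}\le m(n-m)-(m-s)$$ and $$\dim_H\{V\in G(n,m):\underline{\dim}_B\,\pi_V E<\underline{\dim}_B^s E\}\le m(n-m)-(m-s).$$ -/

import Mathlib

open MeasureTheory Filter Topology

noncomputable section

/-- The Euclidean space `ℝⁿ`. -/
abbrev RSpace (n : ℕ) : Type := EuclideanSpace ℝ (Fin n)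

/-- The kernel `φ_r^s(x) = min {1, (r / |x|)^s}`, with the value `1` at `x = 0`. -/
def profileKernel {n : ℕ} (s r : ℝ) (x : RSpace n) : ℝ :=
  open Classical in if x = 0 then 1 else min 1 ((r / ‖x‖) ^ s)

/-- The energy `∫∫ φ_r^s(x - y) dμ(x) dμ(y)`. -/
def kernelEnergy {n : ℕ} (s r : ℝ) (μ : Measure (RSpace n)) : ℝ :=
  ∫ y, ∫ x, profileKernel s r (x - y) ∂μ ∂μ

/-- The energies of all Borel probability measures supported by `E`. -/
def energiesOn {n : ℕ} (s r : ℝ) (E : Set (RSpace n)) : Set ℝ :=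
  {e | ∃ μ : Measure (RSpace n), IsProbabilityMeasure μ ∧ μ Eᶜ = 0 ∧ e = kernelEnergy s r μ}

/-- The capacity `C_r^s(E)` of a non-empty compact set `E`: the reciprocal of the infimum of the
energies of Borel probability measures supported by `E`. -/
def kernelCapacity {n : ℕ} (s r : ℝ) (E : Set (RSpace n)) : ℝ :=
  (sInf (energiesOn s r E))⁻¹

/-- The lower `s`-box dimension profile, `liminf_{r → 0+} log C_r^s(E) / (- log r)`. -/
def lowerBoxProfile {n : ℕ} (s : ℝ) (E : Set (RSpace n)) : EReal :=
  liminf (fun r : ℝ => ((Real.log (kernelCapacity s r E) / (-Real.log r) : ℝ) : EReal)) (𝓝[>] 0)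

/-- The upper `s`-box dimension profile, `limsup_{r → 0+} log C_r^s(E) / (- log r)`. -/
def upperBoxProfile {n : ℕ} (s : ℝ) (E : Set (RSpace n)) : EReal :=
  limsup (fun r : ℝ => ((Real.log (kernelCapacity s r E) / (-Real.log r) : ℝ) : EReal)) (𝓝[>] 0)

/-- `N_r(E)`: the least number of sets of diameter at most `r` that cover the bounded set `E`. -/
def boxCoverNumber {n : ℕ} (r : ℝ) (E : Set (RSpace n)) : ℕ :=
  sInf {k : ℕ | ∃ U : Fin k → Set (RSpace n),
    (∀ i, Bornology.IsBounded (U i) ∧ Metric.diam (U i) ≤ r) ∧ E ⊆ ⋃ i, U i}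

/-- The lower box-counting dimension, `liminf_{r → 0+} log N_r(E) / (- log r)`. -/
def lowerBoxDim {n : ℕ} (E : Set (RSpace n)) : EReal :=
  liminf (fun r : ℝ => ((Real.log (boxCoverNumber r E) / (-Real.log r) : ℝ) : EReal)) (𝓝[>] 0)

/-- The upper box-counting dimension, `limsup_{r → 0+} log N_r(E) / (- log r)`. -/
def upperBoxDim {n : ℕ} (E : Set (RSpace n)) : EReal :=
  limsup (fun r : ℝ => ((Real.log (boxCoverNumber r E) / (-Real.log r) : ℝ) : EReal)) (𝓝[>] 0)

/-- The Grassmannian `G(n, m)` of `m`-dimensional linear subspaces of `ℝⁿ`. -/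
structure GrassmannSpace (n m : ℕ) : Type where
  /-- the underlying subspace -/
  space : Submodule ℝ (RSpace n)
  finrank_eq : Module.finrank ℝ space = m

namespace GrassmannSpace

variable {n m : ℕ}

/-- The orthogonal projection `π_V` onto `V`, as a continuous linear map from `ℝⁿ` to itself. -/
def proj (V : GrassmannSpace n m) : RSpace n →L[ℝ] RSpace n := V.space.starProjection

theorem proj_injective :
    Function.Injective (proj : GrassmannSpace n m → (RSpace n →L[ℝ] RSpace n)) := by
  rintro ⟨V, hV⟩ ⟨W, hW⟩ h
  have h' : V = W := by
    have h2 : V.starProjection = W.starProjection := h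
    rw [← Submodule.range_starProjection V, ← Submodule.range_starProjection W, h2]
  subst h'
  rfl

/-- The metric `d(V, W) = ‖π_V - π_W‖` (operator norm) on `G(n, m)`. -/
instance instMetricSpace : MetricSpace (GrassmannSpace n m) :=
  MetricSpace.induced proj proj_injective inferInstance

end GrassmannSpace

end

/-! The argument is potential-theoretic. Let `r = 2 ^ (-k)`, let `μ` on `E` have nearly minimal
energy, and let `G` be the set of planes `V` with `N_r(π_V E)` at most a constant times `r ^ ε *
C_r^s(E)`. By Cauchy–Schwarz, a projection covered by few `r`-sets forces `(μ × μ){‖π_V(x - y)‖ ≤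
r}` to be at least `1 / N_r(π_V E)` (`one_le_boxCoverNumber_mul`).

A discrete Frostman lemma puts weights with `t`-dimensional growth on an `r`-net of `G`, whose total
mass dominates the `t`-sum of a covering (`exists_frostman_weights`). Integrating the Cauchy–Schwarz
bound against these weights and exchanging sum and integral bounds their mass by a multiple of `r ^
ε`, once the weight of `{V : ‖π_V z‖ ≤ r}` is at most a multiple of `φ_r^s(z)` (`sum_indicator_le`).

That estimate is geometric. With `ρ = r / ‖z‖`, the planes `ρ`-almost orthogonal to `z` lie within
`O(ρ)` of a manifold of dimension `m (n - 1 - m)`, so `O(ρ ^ (-m (n - 1 - m)))` pieces of diameter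
`O(ρ)` cover them (`exists_cells`). Their weight is `O(ρ ^ (t - m (n - 1 - m)))`, hence `O(ρ ^ s)`,
because `t ≥ m (n - m) - (m - s) = m (n - 1 - m) + s`.

The `t`-sums decay geometrically in `k`, so a Borel–Cantelli argument bounds the dimension of the
planes that are bad at infinitely many scales (`dimH_frequently_le`). A strict dimension drop puts
`V` in such a set for some `ε = 1 / (j + 1)`, and countable unions do not raise Hausdorff dimension.
-/

/-! ### Planes almost orthogonal to a vector. -/

/-- A spanning family in an `m`-dimensional real space has a subfamily of `m` vectors over which all
members have coordinates of absolute value at most one. -/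
theorem exists_bounded_coordinates {W ι : Type*} [AddCommGroup W] [Module ℝ W]
    [FiniteDimensional ℝ W] [Finite ι] {m : ℕ} (hW : Module.finrank ℝ W = m) (f : ι → W)
    (hf : Submodule.span ℝ (Set.range f) = ⊤) :
    ∃ (I : Fin m → ι) (a : ι → Fin m → ℝ), LinearIndependent ℝ (f ∘ I) ∧
      (∀ j i, |a j i| ≤ 1) ∧ ∀ j, f j = ∑ i, a j i • f (I i) := by
  classical
  let b : Module.Basis (Fin m) ℝ W := Module.finBasisOfFinrankEq ℝ W hW
  obtain ⟨g, hg1, hg2, hg3⟩ := Submodule.exists_fun_fin_finrank_span_eq ℝ (Set.range f)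
  have hm : Module.finrank ℝ (Submodule.span ℝ (Set.range f)) = m := by
    rw [hf, finrank_top, hW]
  choose J hJ using hg1
  let I₀ : Fin m → ι := fun i => J (Fin.cast hm.symm i)
  have hI₀ : b.det (f ∘ I₀) ≠ 0 := by
    have h1 : f ∘ I₀ = g ∘ Fin.cast hm.symm := by
      funext i; simp [I₀, hJ]
    have h2 : IsUnit (b.det (f ∘ I₀)) := by
      rw [← Module.Basis.is_basis_iff_det]
      refine ⟨?_, ?_⟩
      · rw [h1]; exact hg3.comp _ (Fin.cast_injective _)
      · rw [h1, Set.range_comp, (show Function.Surjective (Fin.cast hm.symm) from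
          (finCongr hm.symm).surjective).range_eq,
          Set.image_univ, hg2, hf]
    exact h2.ne_zero
  have : Nonempty (Fin m → ι) := ⟨I₀⟩
  -- A subfamily of maximal determinant: by Cramer's rule each coordinate is a ratio of two such
  -- determinants with this one below, so it is at most one in absolute value.
  obtain ⟨I, hI⟩ := Finite.exists_max (fun I : Fin m → ι => |b.det (f ∘ I)|)
  have hI0 : b.det (f ∘ I) ≠ 0 := by
    intro h
    have := hI I₀
    rw [h, abs_zero] at this
    exact hI₀ (abs_nonpos_iff.mp this)
  obtain ⟨hli, hsp⟩ := (Module.Basis.is_basis_iff_det b).2 (isUnit_iff_ne_zero.2 hI0)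
  let c : Module.Basis (Fin m) ℝ W := Module.Basis.mk hli hsp.ge
  have hc : ⇑c = f ∘ I := Module.Basis.coe_mk _ _
  refine ⟨I, fun j i => c.repr (f j) i, hli, ?_, ?_⟩
  · intro j i
    have h1 : b.det (Function.update c i (f j)) = b.det c * c.repr (f j) i := by
      conv_lhs => rw [AlternatingMap.eq_smul_basis_det c b.det]
      rw [AlternatingMap.smul_apply, smul_eq_mul, c.det_apply,
        Module.Basis.toMatrix_update, Module.Basis.toMatrix_self, ← Matrix.cramer_apply,
        Matrix.cramer_one]
      rfl
    have h2 : Function.update c i (f j) = f ∘ Function.update I i j := by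
      rw [hc, Function.comp_update]
    have h3 := hI (Function.update I i j)
    rw [← h2, h1, hc, abs_mul] at h3
    have : 0 < |b.det (f ∘ I)| := abs_pos.2 hI0
    exact (mul_le_iff_le_one_right this).1 h3
  · intro j
    conv_lhs => rw [← c.sum_repr (f j)]
    simp [hc]

open Submodule in
/-- Two subspaces that are mutually `c`-close have `2c`-close orthogonal projections. -/
theorem norm_starProjection_sub_le {F : Type*} [NormedAddCommGroup F] [InnerProductSpace ℝ F]
    [FiniteDimensional ℝ F] (V W : Submodule ℝ F) {c : ℝ} (hc : 0 ≤ c)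
    (hVW : ∀ v ∈ V, ∃ w ∈ W, ‖v - w‖ ≤ c * ‖v‖) (hWV : ∀ w ∈ W, ∃ v ∈ V, ‖w - v‖ ≤ c * ‖w‖) :
    ‖V.starProjection - W.starProjection‖ ≤ 2 * c := by
  refine ContinuousLinearMap.opNorm_le_bound _ (by positivity) fun z => ?_
  have e1 : ‖V.starProjection z - W.starProjection (V.starProjection z)‖ ≤ c * ‖z‖ := by
    obtain ⟨w, hw, h⟩ := hVW _ (starProjection_apply_mem V z)
    calc _ ≤ ‖V.starProjection z - w‖ := by
          rw [starProjection_minimal]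
          exact ciInf_le ⟨0, by rintro _ ⟨x, rfl⟩; positivity⟩ (⟨w, hw⟩ : W)
      _ ≤ c * ‖V.starProjection z‖ := h
      _ ≤ _ := by gcongr; exact norm_starProjection_apply_le V z
  have e2 : ‖W.starProjection (z - V.starProjection z)‖ ≤ c * ‖z‖ := by
    set u := z - V.starProjection z with hu
    have huz : ‖u‖ ≤ ‖z‖ := by
      have := norm_starProjection_apply_le Vᗮ z
      rwa [starProjection_orthogonal_val] at this
    have huV : u ∈ Vᗮ := sub_starProjection_mem_orthogonal z
    set q := W.starProjection u with hq
    have hqW : q ∈ W := starProjection_apply_mem W u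
    obtain ⟨v, hv, h⟩ := hWV q hqW
    -- Since `u ⊥ V`, replacing `q` by `q - v` costs nothing in the inner product and gains the
    -- factor `c`.
    have h1 : inner ℝ q q = inner ℝ (q - v) u := by
      rw [inner_sub_left, (mem_orthogonal V u).1 huV v hv, sub_zero]
      conv_lhs => rw [hq, inner_starProjection_left_eq_right, ← hq,
        (starProjection_eq_self_iff).2 hqW, real_inner_comm]
    have h2 : ‖q‖ * ‖q‖ ≤ (c * ‖q‖) * ‖z‖ := by
      rw [← real_inner_self_eq_norm_mul_norm, h1]
      calc _ ≤ ‖q - v‖ * ‖u‖ := real_inner_le_norm _ _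
        _ ≤ _ := by gcongr
    rcases (norm_nonneg q).eq_or_lt with h0 | h0
    · rw [← h0]; positivity
    · nlinarith
  have : (V.starProjection - W.starProjection) z =
      (V.starProjection z - W.starProjection (V.starProjection z)) -
        W.starProjection (z - V.starProjection z) := by
    simp
  rw [this]
  calc _ ≤ _ := norm_sub_le _ _
    _ ≤ _ := by linarith

theorem OrthonormalBasis.norm_le_sum_abs_inner {n : ℕ}
    (b : OrthonormalBasis (Fin n) ℝ (RSpace n)) (v : RSpace n) :
    ‖v‖ ≤ ∑ j, |inner ℝ (b j) v| := by
  conv_lhs => rw [← b.sum_repr' v]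
  refine (norm_sum_le _ _).trans (Finset.sum_le_sum fun j _ => ?_)
  rw [norm_smul, b.norm_eq_one, mul_one, Real.norm_eq_abs]

/-- A subspace almost orthogonal to the basis vector `b i₀` is the graph of a linear map over `m` of
the other coordinates, with entries bounded by one and with small `i₀`-th row. -/
theorem exists_graph_coordinates {n m : ℕ} (b : OrthonormalBasis (Fin n) ℝ (RSpace n))
    (i₀ : Fin n) (V : Submodule ℝ (RSpace n)) (hV : Module.finrank ℝ V = m) {ρ : ℝ}
    (hρ : ρ ≤ 1 / 2) (hb : ‖V.starProjection (b i₀)‖ ≤ ρ) :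
    ∃ (I : Fin m → Fin n) (a : Fin n → Fin m → ℝ), Function.Injective I ∧ (∀ i, I i ≠ i₀) ∧
      (∀ j, j ≠ i₀ → ∀ i, |a j i| ≤ 1) ∧ (∀ i, |a i₀ i| ≤ 2 * n * ρ) ∧
      (∀ i k, a (I i) k = if i = k then 1 else 0) ∧
      (∀ v ∈ V, ∀ j, inner ℝ (b j) v = ∑ i, a j i * inner ℝ (b (I i)) v) ∧
      (∀ y : Fin m → ℝ, ∃ v ∈ V, ∀ i, inner ℝ (b (I i)) v = y i) := by
  classical
  let f : Fin n → V := fun j => V.orthogonalProjectionOnto (b j)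
  have hfi : ∀ j (v : V), inner ℝ (f j) v = inner ℝ (b j) (v : RSpace n) := fun j v =>
    Submodule.inner_orthogonalProjectionOnto_eq_of_mem_right v (b j)
  have hcoord : ∀ v : V, |inner ℝ (b i₀) (v : RSpace n)| ≤ ρ * ‖(v : RSpace n)‖ := by
    intro v
    rw [← hfi]
    calc _ ≤ ‖f i₀‖ * ‖v‖ := abs_real_inner_le_norm _ _
      _ ≤ _ := by
        have : ‖f i₀‖ ≤ ρ := hb
        exact mul_le_mul_of_nonneg_right this (norm_nonneg _)
  have hexp := b.norm_le_sum_abs_inner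
  -- A vector of `V` orthogonal to all these projections is a multiple of `b i₀`, while `ρ < 1`
  -- makes the `b i₀`-coordinate of a nonzero vector of `V` shorter than the vector.
  have hspan : Submodule.span ℝ (Set.range fun j : {j // j ≠ i₀} => f j) = ⊤ := by
    rw [← Submodule.orthogonal_eq_bot_iff, Submodule.eq_bot_iff]
    intro v hv
    have h0 : ∀ j, j ≠ i₀ → inner ℝ (b j) (v : RSpace n) = 0 := by
      intro j hj
      rw [← hfi]
      exact (Submodule.mem_orthogonal _ _).1 hv _ (Submodule.subset_span ⟨⟨j, hj⟩, rfl⟩)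
    have h1 : ‖(v : RSpace n)‖ ≤ |inner ℝ (b i₀) (v : RSpace n)| := by
      refine (hexp v).trans (le_of_eq ?_)
      refine Finset.sum_eq_single i₀ (fun j _ hj => by rw [h0 j hj, abs_zero]) (by simp)
    have h2 := hcoord v
    have h3 := norm_nonneg (v : RSpace n)
    have h4 : ‖(v : RSpace n)‖ = 0 := by nlinarith
    exact_mod_cast norm_eq_zero.1 h4
  obtain ⟨I', a', hli, ha', hrel'⟩ := exists_bounded_coordinates hV _ hspan
  let I : Fin m → Fin n := fun i => (I' i : Fin n)
  have hli' : LinearIndependent ℝ (f ∘ I) := hli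
  have hV' : Fintype.card (Fin m) = Module.finrank ℝ V := by simp [hV]
  let c : Module.Basis (Fin m) ℝ V := Module.Basis.mk hli'
    (hli'.span_eq_top_of_card_eq_finrank' hV').ge
  have hc : ∀ i, c i = f (I i) := fun i => by simp [c]
  let a : Fin n → Fin m → ℝ := fun j i => c.repr (f j) i
  have hrel : ∀ j, f j = ∑ i, a j i • f (I i) := fun j => by
    conv_lhs => rw [← c.sum_repr (f j)]
    simp [hc, a]
  have haa : ∀ j (hj : j ≠ i₀) i, a j i = a' ⟨j, hj⟩ i := by
    intro j hj i
    have h := hrel' ⟨j, hj⟩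
    simp only at h
    have h2 : f j = ∑ i, a' ⟨j, hj⟩ i • c i := by rw [h]; simp [hc, I]
    simp only [a]
    rw [h2, c.repr_sum_self]
  have hinner : ∀ v ∈ V, ∀ j, inner ℝ (b j) v = ∑ i, a j i * inner ℝ (b (I i)) v := by
    intro v hv j
    rw [← hfi j ⟨v, hv⟩, hrel j, sum_inner]
    refine Finset.sum_congr rfl fun i _ => ?_
    rw [← hfi (I i) ⟨v, hv⟩]
    exact real_inner_smul_left (f (I i)) (⟨v, hv⟩ : V) (a j i)
  have hsurj : ∀ y : Fin m → ℝ, ∃ v ∈ V, ∀ i, inner ℝ (b (I i)) v = y i := by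
    let L : V →ₗ[ℝ] (Fin m → ℝ) := LinearMap.pi fun i => (innerₗ V (f (I i)))
    have hL : ∀ v i, L v i = inner ℝ (b (I i)) (v : RSpace n) := fun v i => hfi _ _
    have hinj : Function.Injective L := by
      rw [← LinearMap.ker_eq_bot, LinearMap.ker_eq_bot']
      intro v hv
      have h0 : ∀ j, inner ℝ (b j) (v : RSpace n) = 0 := by
        intro j
        rw [hinner v v.2 j]
        refine Finset.sum_eq_zero fun i _ => ?_
        rw [← hL, hv]; simp
      have h1 := hexp v
      simp only [h0, abs_zero, Finset.sum_const_zero] at h1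
      exact_mod_cast norm_le_zero_iff.1 h1
    have hs := (LinearMap.injective_iff_surjective_of_finrank_eq_finrank (by simp [hV])).1 hinj
    intro y
    obtain ⟨v, hv⟩ := hs y
    exact ⟨v, v.2, fun i => by rw [← hL, hv]⟩
  have hone : ∀ j, j ≠ i₀ → ∀ i, |a j i| ≤ 1 := fun j hj i => by
    rw [haa j hj]; exact ha' _ _
  refine ⟨I, a, ?_, fun i => (I' i).2, hone, ?_, ?_, hinner, hsurj⟩
  · exact fun i k h => hli'.injective (by simp [h])
  · intro i
    -- The coordinates of this `v` form column `i` of `a`. Hence `|a i₀ i| ≤ ρ * ‖v‖ ≤ ρ * (n + |a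
    -- i₀ i|)`, and `ρ ≤ 1 / 2` absorbs the last term.
    obtain ⟨v, hv, hvi⟩ := hsurj (Pi.single i 1)
    have h1 : ∀ j, inner ℝ (b j) v = a j i := by
      intro j
      rw [hinner v hv j]
      simp [hvi, Pi.single_apply]
    have h2 : ‖v‖ ≤ n + |a i₀ i| := by
      refine (hexp v).trans ?_
      simp only [h1]
      calc ∑ j, |a j i| ≤ ∑ j, (1 + if j = i₀ then |a i₀ i| else 0) := by
            refine Finset.sum_le_sum fun j _ => ?_
            by_cases hj : j = i₀
            · simp [hj]
            · simpa [hj] using hone j hj i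
        _ = _ := by simp [Finset.sum_add_distrib]
    have h3 := hcoord ⟨v, hv⟩
    simp only [h1] at h3
    have hρ0 : 0 ≤ ρ := (norm_nonneg _).trans hb
    have h4 := abs_nonneg (a i₀ i)
    nlinarith [mul_le_mul_of_nonneg_left h2 hρ0]
  · intro i k
    simp only [a]
    rw [← hc, c.repr_self, Finsupp.single_apply]

/-- Graphs over the same coordinates with nearby matrices are close to each other. -/
theorem exists_near_of_graph_coordinates {n m : ℕ} (b : OrthonormalBasis (Fin n) ℝ (RSpace n))
    (V W : Submodule ℝ (RSpace n)) (I : Fin m → Fin n) (a a' : Fin n → Fin m → ℝ) {c : ℝ}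
    (hV : ∀ v ∈ V, ∀ j, inner ℝ (b j) v = ∑ i, a j i * inner ℝ (b (I i)) v)
    (hW : ∀ v ∈ W, ∀ j, inner ℝ (b j) v = ∑ i, a' j i * inner ℝ (b (I i)) v)
    (hW' : ∀ y : Fin m → ℝ, ∃ v ∈ W, ∀ i, inner ℝ (b (I i)) v = y i)
    (haa : ∀ j i, |a j i - a' j i| ≤ c) (v : RSpace n) (hv : v ∈ V) :
    ∃ w ∈ W, ‖v - w‖ ≤ (n * m * c) * ‖v‖ := by
  obtain ⟨w, hw, hwi⟩ := hW' fun i => inner ℝ (b (I i)) v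
  refine ⟨w, hw, (b.norm_le_sum_abs_inner _).trans ?_⟩
  have h : ∀ j, |inner ℝ (b j) (v - w)| ≤ m * (c * ‖v‖) := by
    intro j
    rw [inner_sub_right, hV v hv, hW w hw, ← Finset.sum_sub_distrib]
    refine (Finset.abs_sum_le_sum_abs _ _).trans ?_
    calc _ ≤ ∑ _i : Fin m, c * ‖v‖ := by
          refine Finset.sum_le_sum fun i _ => ?_
          rw [hwi, ← sub_mul, abs_mul]
          have h2 : |inner ℝ (b (I i)) v| ≤ ‖v‖ := by
            simpa using abs_real_inner_le_norm (b (I i)) v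
          exact mul_le_mul (haa j i) h2 (abs_nonneg _) ((abs_nonneg _).trans (haa j i))
      _ = _ := by simp
  calc _ ≤ ∑ _j : Fin n, m * (c * ‖v‖) := Finset.sum_le_sum fun j _ => h j
    _ = _ := by simp; ring

/-- The `m`-planes almost orthogonal to a unit vector, up to `ρ`, split into
`O(ρ ^ (-m (n - 1 - m)))` classes of diameter `O(ρ)`. -/
theorem GrassmannSpace.exists_cells (n m : ℕ) (hmn : m < n) :
    ∃ C : ℝ, 1 ≤ C ∧ ∀ x : RSpace n, ‖x‖ = 1 → ∀ ρ : ℝ, 0 < ρ → ρ ≤ 1 / 2 →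
      ∃ (T : Type) (F : Finset T) (c : GrassmannSpace n m → T),
        (F.card : ℝ) ≤ C * (1 / ρ) ^ (m * (n - 1 - m)) ∧
        (∀ V : GrassmannSpace n m, ‖V.proj x‖ ≤ ρ → c V ∈ F) ∧
        ∀ V W : GrassmannSpace n m, ‖V.proj x‖ ≤ ρ → ‖W.proj x‖ ≤ ρ → c V = c W →
          dist V W ≤ C * ρ := by
  classical
  refine ⟨max 1 (max ((n : ℝ) ^ m * 5 ^ (m * (n - 1 - m))) (2 * (n * m * (4 * n)))),
    le_max_left _ _, ?_⟩
  intro x hx ρ hρ hρ2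
  have hn : 0 < n := by omega
  let i₀ : Fin n := ⟨0, hn⟩
  obtain ⟨b, hb⟩ : ∃ b : OrthonormalBasis (Fin n) ℝ (RSpace n), b i₀ = x := by
    obtain ⟨b, hb⟩ := Orthonormal.exists_orthonormalBasis_extension_of_card_eq (𝕜 := ℝ)
      (E := RSpace n) (ι := Fin n) (by simp) (v := fun _ => x) (s := {i₀})
      ⟨fun _ => hx, fun i j h => absurd (Subsingleton.elim i j) h⟩
    exact ⟨b, hb i₀ rfl⟩
  have key : ∀ V : GrassmannSpace n m, ‖V.proj x‖ ≤ ρ → _ := fun V hV =>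
    exists_graph_coordinates b i₀ V.space V.finrank_eq hρ2 (by rw [hb]; exact hV)
  have : Nonempty (Fin m → Fin n) := ⟨fun _ => i₀⟩
  choose! I a hI hI₀ ha ha₀ haI hrel hsurj using key
  let N : ℕ := ⌈1 / ρ⌉₊
  -- Rows in `J` form the identity and row `i₀` is already `O(ρ)`, so neither needs discretising.
  -- The `n - 1 - m` rows left, with `m` entries each, give the exponent.
  let K (J : Fin m → Fin n) (j : Fin n) : Finset ℤ :=
    if j = i₀ ∨ j ∈ Set.range J then {0} else Finset.Icc (-(N : ℤ)) N
  let F : Finset (Σ _ : Fin m → Fin n, (Fin n → Fin m → ℤ)) :=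
    (Finset.univ.filter fun J : Fin m → Fin n => Function.Injective J ∧ ∀ i, J i ≠ i₀).sigma
      fun J => Fintype.piFinset fun j => Fintype.piFinset fun _ => K J j
  refine ⟨_, F, fun V => ⟨I V, fun j i =>
    if j = i₀ ∨ j ∈ Set.range (I V) then 0 else ⌊a V j i / ρ⌋⟩, ?_, ?_, ?_⟩
  · have hNρ : ((2 * N + 1 : ℕ) : ℝ) ≤ 5 * (1 / ρ) := by
      have h1 : (N : ℝ) < 1 / ρ + 1 := Nat.ceil_lt_add_one (by positivity)
      have h2 : 2 ≤ 1 / ρ := by rw [le_div_iff₀ hρ]; linarith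
      push_cast; linarith
    have hcard : F.card ≤ n ^ m * (2 * N + 1) ^ (m * (n - 1 - m)) := by
      rw [Finset.card_sigma]
      have hJ : ∀ J ∈ Finset.univ.filter
          (fun J : Fin m → Fin n => Function.Injective J ∧ ∀ i, J i ≠ i₀),
          (Fintype.piFinset fun j => Fintype.piFinset fun _ : Fin m => K J j).card =
            (2 * N + 1) ^ (m * (n - 1 - m)) := by
        intro J hJ
        obtain ⟨hJ1, hJ2⟩ := (Finset.mem_filter.1 hJ).2
        have hK : ∀ j, (K J j).card =
            if j = i₀ ∨ j ∈ Set.range J then 1 else 2 * N + 1 := by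
          intro j
          simp only [K]
          split_ifs
          · simp
          · rw [Int.card_Icc]; omega
        have hc : (Finset.univ.filter fun j => ¬ (j = i₀ ∨ j ∈ Set.range J)).card
            = n - 1 - m := by
          have h1 : (Finset.univ.filter fun j => ¬ (j = i₀ ∨ j ∈ Set.range J)) =
              (insert i₀ (Finset.univ.image J))ᶜ := by
            ext j; simp
          rw [h1, Finset.card_compl, Finset.card_insert_of_notMem (by simpa using hJ2),
            Finset.card_image_of_injective _ hJ1]
          simp; omega
        simp only [Fintype.card_piFinset, Finset.prod_const, hK, Finset.card_univ,
          Fintype.card_fin]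
        rw [Finset.prod_pow, Finset.prod_ite]
        simp only [Finset.prod_const, one_pow, one_mul, hc]
        rw [← pow_mul, mul_comm m]
      rw [Finset.sum_congr rfl hJ, Finset.sum_const, smul_eq_mul]
      gcongr
      exact (Finset.card_filter_le _ _).trans (by simp)
    calc (F.card : ℝ) ≤ (n : ℝ) ^ m * ((2 * N + 1 : ℕ) : ℝ) ^ (m * (n - 1 - m)) := by
          exact_mod_cast hcard
      _ ≤ (n : ℝ) ^ m * (5 * (1 / ρ)) ^ (m * (n - 1 - m)) := by gcongr
      _ = ((n : ℝ) ^ m * 5 ^ (m * (n - 1 - m))) * (1 / ρ) ^ (m * (n - 1 - m)) := by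
          rw [mul_pow, mul_assoc]
      _ ≤ _ := by
          gcongr
          exact (le_max_left _ _).trans (le_max_right _ _)
  · intro V hV
    simp only [F, Finset.mem_sigma, Finset.mem_filter, Finset.mem_univ, true_and,
      Fintype.mem_piFinset, K]
    refine ⟨⟨hI V hV, hI₀ V hV⟩, fun j i => ?_⟩
    split_ifs with h
    · simp
    · push Not at h
      have h1 := abs_le.1 (ha V hV j h.1 i)
      have h2 : (1 / ρ) ≤ N := Nat.le_ceil _
      rw [Finset.mem_Icc]
      constructor
      · rw [Int.le_floor]
        push_cast
        rw [le_div_iff₀ hρ]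
        have := (div_le_iff₀ hρ).1 h2
        linarith
      · have h3 : (⌊a V j i / ρ⌋ : ℝ) ≤ a V j i / ρ := Int.floor_le _
        have h4 : a V j i / ρ ≤ 1 / ρ := by gcongr; exact h1.2
        exact_mod_cast (h3.trans h4).trans h2
  · intro V W hV hW hVW
    obtain ⟨hII, hg⟩ := Sigma.mk.inj hVW
    have hg := eq_of_heq hg
    have hn1 : (1 : ℝ) ≤ n := by exact_mod_cast hn
    have haa : ∀ j i, |a V j i - a W j i| ≤ 4 * n * ρ := by
      intro j i
      by_cases h0 : j = i₀
      · subst h0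
        have h1 := ha₀ V hV i
        have h2 := ha₀ W hW i
        exact (abs_sub _ _).trans (by linarith)
      · by_cases h1 : j ∈ Set.range (I V)
        · obtain ⟨k, rfl⟩ := h1
          rw [haI V hV]
          rw [hII, haI W hW, sub_self, abs_zero]
          positivity
        · have h2 := congrFun (congrFun hg j) i
          simp only [h0, h1, ← hII, or_self, if_false] at h2
          have h3 := Int.abs_sub_lt_one_of_floor_eq_floor h2
          rw [← sub_div, abs_div, abs_of_pos hρ, div_lt_one hρ] at h3
          nlinarith
    have haa' : ∀ j i, |a W j i - a V j i| ≤ 4 * n * ρ := fun j i => by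
      rw [abs_sub_comm]; exact haa j i
    have hW1 := hrel W hW
    have hW2 := hsurj W hW
    rw [← hII] at hW1 hW2
    have h := norm_starProjection_sub_le V.space W.space (c := n * m * (4 * n * ρ))
      (by positivity)
      (exists_near_of_graph_coordinates b _ _ (I V) _ _ (hrel V hV) hW1 hW2 haa)
      (exists_near_of_graph_coordinates b _ _ (I V) _ _ hW1 (hrel V hV) (hsurj V hV) haa')
    have hd : dist V W = ‖V.space.starProjection - W.space.starProjection‖ :=
      dist_eq_norm V.proj W.proj
    rw [hd]
    calc _ ≤ _ := h
      _ = (2 * (n * m * (4 * n))) * ρ := by ring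
      _ ≤ _ := by
        gcongr
        exact (le_max_right _ _).trans (le_max_right _ _)

/-! ### A discrete Frostman lemma. -/

/-- Given finitely many upper bounds for sums of non-negative weights on a finite set, the weights
can be chosen so that every point lies in a set whose bound is attained. -/
theorem exists_weights_tight {X ι : Type*} (P : Finset X) (K : Finset ι) (B : ι → Set X)
    (β : ι → ℝ) (hβ : ∀ i ∈ K, 0 ≤ β i) (hcov : ∀ p ∈ P, ∃ i ∈ K, p ∈ B i) :
    ∃ w : X → ℝ, (∀ p, 0 ≤ w p) ∧ (∀ i ∈ K, ∑ p ∈ P, (B i).indicator w p ≤ β i) ∧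
      ∀ p ∈ P, ∃ i ∈ K, p ∈ B i ∧ ∑ p ∈ P, (B i).indicator w p = β i := by
  classical
  suffices H : ∀ Q : Finset X, Q ⊆ P → ∃ w : X → ℝ, (∀ p, 0 ≤ w p) ∧
      (∀ i ∈ K, ∑ p ∈ P, (B i).indicator w p ≤ β i) ∧
      ∀ p ∈ Q, ∃ i ∈ K, p ∈ B i ∧ ∑ p ∈ P, (B i).indicator w p = β i from H P subset_rfl
  intro Q
  induction Q using Finset.induction_on with
  | empty => exact fun _ => ⟨0, by simp, by simpa using hβ, by simp⟩
  | insert p Q _ ih =>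
    intro hQ
    obtain ⟨w, hw0, hwK, hwQ⟩ := ih ((Finset.subset_insert _ _).trans hQ)
    have hp : p ∈ P := hQ (Finset.mem_insert_self _ _)
    obtain ⟨i₁, hi₁, hpi₁⟩ := hcov p hp
    -- Greedy step: add at `p` the smallest slack among the constraints containing `p`. That
    -- constraint becomes tight, none is violated, and tight ones stay tight because weights only
    -- grow.
    obtain ⟨i₀, hi₀, hmin⟩ := (K.filter fun i => p ∈ B i).exists_min_image
      (fun i => β i - ∑ q ∈ P, (B i).indicator w q) ⟨i₁, Finset.mem_filter.2 ⟨hi₁, hpi₁⟩⟩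
    obtain ⟨hi₀K, hpi₀⟩ := Finset.mem_filter.1 hi₀
    set δ := β i₀ - ∑ q ∈ P, (B i₀).indicator w q with hδ
    have hδ0 : 0 ≤ δ := sub_nonneg.2 (hwK i₀ hi₀K)
    have hsum : ∀ i, ∑ q ∈ P, (B i).indicator (w + Pi.single p δ) q =
        ∑ q ∈ P, (B i).indicator w q + if p ∈ B i then δ else 0 := by
      intro i
      simp only [Set.indicator_add', Pi.add_apply, Finset.sum_add_distrib]
      congr 1
      rw [Finset.sum_eq_single p]
      · simp [Set.indicator_apply]
      · intro q _ hq
        simp [Set.indicator_apply, hq]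
      · exact fun h => absurd hp h
    refine ⟨w + Pi.single p δ, ?_, ?_, ?_⟩
    · intro q
      have : (0 : X → ℝ) ≤ Pi.single p δ := Pi.single_nonneg.2 hδ0
      exact add_nonneg (hw0 q) (this q)
    · intro i hi
      rw [hsum]
      split_ifs with h
      · have := hmin i (Finset.mem_filter.2 ⟨hi, h⟩)
        linarith
      · simpa using hwK i hi
    · intro q hq
      rcases Finset.mem_insert.1 hq with rfl | hq
      · refine ⟨i₀, hi₀K, hpi₀, ?_⟩
        rw [hsum, if_pos hpi₀]; linarith
      · obtain ⟨i, hi, hqi, hi'⟩ := hwQ q hq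
        refine ⟨i, hi, hqi, ?_⟩
        rw [hsum]
        split_ifs with h
        · have := hmin i (Finset.mem_filter.2 ⟨hi, h⟩)
          linarith
        · rw [add_zero, hi']

/-- A discrete Frostman lemma: a finite set carries weights satisfying a growth condition at scales
above `2 ^ (-k)`, whose total mass dominates the `t`-sum of a covering by balls of such radii. -/
theorem exists_frostman_weights {X : Type*} [PseudoMetricSpace X] (P : Finset X) (k : ℕ) {t : ℝ}
    (ht : 0 ≤ t) (hd : ∀ x y : X, dist x y ≤ 2) :
    ∃ w : X → ℝ, (∀ p, 0 ≤ w p) ∧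
      (∀ p ∈ P, ∀ l : ℝ, (1 / 2) ^ k ≤ l →
        ∑ q ∈ P, (Metric.closedBall p l).indicator w q ≤ (2 * l) ^ t) ∧
      ∃ U : Finset (X × ℝ), (∀ c ∈ U, (1 / 2) ^ k ≤ c.2) ∧
        ∑ c ∈ U, c.2 ^ t ≤ ∑ p ∈ P, w p ∧
        ∀ p ∈ P, ∃ c ∈ U, p ∈ Metric.closedBall c.1 (5 * c.2) := by
  classical
  -- The radii run from `2`, whose balls are the whole space, down to exactly `2 ^ (-k)`, attained
  -- at `j = k + 1`.
  let R : Finset ℝ := (Finset.range (k + 2)).image fun j => 2 * (1 / 2 : ℝ) ^ j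
  have hR : ∀ ρ ∈ R, (1 / 2) ^ k ≤ ρ ∧ ρ ≤ 2 := by
    intro ρ hρ
    obtain ⟨j, hj, rfl⟩ := Finset.mem_image.1 hρ
    have hj : j ≤ k + 1 := by have := Finset.mem_range.1 hj; omega
    have h1 : (1 / 2 : ℝ) ^ (k + 1) ≤ (1 / 2) ^ j :=
      pow_le_pow_of_le_one (by norm_num) (by norm_num) hj
    have h2 : (1 / 2 : ℝ) ^ j ≤ 1 := pow_le_one₀ (by norm_num) (by norm_num)
    rw [pow_succ] at h1
    constructor <;> linarith
  have hpos : ∀ ρ ∈ R, 0 < ρ := fun ρ hρ => lt_of_lt_of_le (by positivity) (hR ρ hρ).1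
  have h2R : (2 : ℝ) ∈ R := Finset.mem_image.2 ⟨0, by simp, by simp⟩
  obtain ⟨w, hw0, hwK, hwt⟩ := exists_weights_tight P (P ×ˢ R)
    (fun c => Metric.closedBall c.1 c.2) (fun c => c.2 ^ t)
    (fun c hc => Real.rpow_nonneg (hpos _ (Finset.mem_product.1 hc).2).le _)
    (fun p hp => ⟨(p, 2), Finset.mem_product.2 ⟨hp, h2R⟩, hd _ _⟩)
  refine ⟨w, hw0, ?_, ?_⟩
  · intro p hp l hl
    have hl0 : 0 < l := lt_of_lt_of_le (by positivity) hl
    have hsub : ∃ ρ ∈ R, ρ ≤ 2 * l ∧ Metric.closedBall p l ⊆ Metric.closedBall p ρ := by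
      rcases le_or_gt 2 l with h | h
      · exact ⟨2, h2R, by linarith, fun x _ => hd _ _⟩
      · obtain ⟨j, hj1, hj2⟩ := exists_nat_pow_near_of_lt_one (x := l / 2) (y := (1 / 2 : ℝ))
          (by positivity) (by linarith) (by norm_num) (by norm_num)
        refine ⟨2 * (1 / 2) ^ j, Finset.mem_image.2 ⟨j, ?_, rfl⟩, ?_,
          Metric.closedBall_subset_closedBall (by linarith)⟩
        · have h1 : (1 / 2 : ℝ) ^ (k + 1) ≤ (1 / 2) ^ j := by rw [pow_succ]; linarith
          have := (pow_le_pow_iff_right_of_lt_one₀ (by norm_num) (by norm_num)).1 h1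
          exact Finset.mem_range.2 (by omega)
        · rw [pow_succ] at hj1; linarith
    obtain ⟨ρ, hρ, hρl, hs⟩ := hsub
    calc _ ≤ ∑ q ∈ P, (Metric.closedBall p ρ).indicator w q :=
          Finset.sum_le_sum fun q _ => Set.indicator_le_indicator_of_subset hs (fun q => hw0 q) q
      _ ≤ ρ ^ t := hwK (p, ρ) (Finset.mem_product.2 ⟨hp, hρ⟩)
      _ ≤ _ := Real.rpow_le_rpow (hpos ρ hρ).le hρl ht
  · let T : Set (X × ℝ) := {c | c ∈ P ×ˢ R ∧
      ∑ p ∈ P, (Metric.closedBall c.1 c.2).indicator w p = c.2 ^ t}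
    obtain ⟨u, huT, hdis, hcov⟩ := Vitali.exists_disjoint_subfamily_covering_enlargement_closedBall
      T (fun c => c.1) (fun c => c.2) 2 (fun c hc => (hR _ (Finset.mem_product.1 hc.1).2).2)
      5 (by norm_num)
    have hfin : u.Finite := ((P ×ˢ R).finite_toSet).subset fun c hc => (huT hc).1
    have hmem : ∀ c ∈ hfin.toFinset, c ∈ T := fun c hc => huT (hfin.mem_toFinset.1 hc)
    refine ⟨hfin.toFinset, fun c hc => (hR _ (Finset.mem_product.1 (hmem c hc).1).2).1, ?_, ?_⟩
    · calc ∑ c ∈ hfin.toFinset, c.2 ^ t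
          = ∑ c ∈ hfin.toFinset, ∑ p ∈ P, (Metric.closedBall c.1 c.2).indicator w p :=
            Finset.sum_congr rfl fun c hc => (hmem c hc).2.symm
        _ = ∑ p ∈ P, ∑ c ∈ hfin.toFinset, (Metric.closedBall c.1 c.2).indicator w p :=
            Finset.sum_comm
        _ ≤ _ := by
          refine Finset.sum_le_sum fun p _ => ?_
          have h := Finset.indicator_biUnion hfin.toFinset
            (fun c : X × ℝ => Metric.closedBall c.1 c.2) (f := w)
            (by rw [hfin.coe_toFinset]; exact hdis)
          rw [← congrFun h p]
          exact Set.indicator_le_self' (fun _ _ => hw0 _) p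
    · intro p hp
      obtain ⟨c, hc, hpc, hct⟩ := hwt p hp
      obtain ⟨d, hd, hcd⟩ := hcov c ⟨hc, hct⟩
      exact ⟨d, hfin.mem_toFinset.2 hd, hcd hpc⟩

/-! ### Hausdorff dimension of limsup sets. -/

/-- A set of points lying in infinitely many `G k`, where `G k` has coverings by balls with
geometrically decaying `t`-sums, has Hausdorff dimension at most `t`. -/
theorem dimH_frequently_le {X : Type*} [MetricSpace X] (G : ℕ → Set X) {t C q : ℝ} (ht : 0 < t)
    (hC : 0 ≤ C) (hq0 : 0 ≤ q) (hq1 : q < 1)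
    (h : ∀ k, ∃ U : Finset (X × ℝ), (∀ c ∈ U, 0 ≤ c.2) ∧ ∑ c ∈ U, c.2 ^ t ≤ C * q ^ k ∧
      G k ⊆ ⋃ c ∈ U, Metric.closedBall c.1 c.2) :
    dimH {x | ∃ᶠ k in atTop, x ∈ G k} ≤ ENNReal.ofReal t := by
  borelize X
  choose U hU0 hUs hUc using h
  have hpow : Tendsto (fun k : ℕ => q ^ k) atTop (𝓝 0) := tendsto_pow_atTop_nhds_zero_of_lt_one hq0 hq1
  have hdiam : ∀ c : X × ℝ, Metric.ediam (Metric.closedBall c.1 c.2) ≤ ENNReal.ofReal (2 * c.2) := by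
    intro c
    refine Metric.ediam_le fun x hx y hy => ?_
    rw [edist_dist]
    refine ENNReal.ofReal_le_ofReal ?_
    have := dist_triangle_right x y c.1
    rw [Metric.mem_closedBall] at hx hy
    linarith
  have hμ : Measure.hausdorffMeasure t {x | ∃ᶠ k in atTop, x ∈ G k} = 0 := by
    -- For each `n` the covers of index at least `n` together cover the limsup set, with `t`-sum a
    -- geometric tail. A single term of a `t`-sum already bounds its radius, which gives the
    -- vanishing mesh.
    have hle := Measure.hausdorffMeasure_le_liminf_tsum
      (ι := fun n : ℕ => Σ k : ℕ, {c // c ∈ U (n + k)}) t {x | ∃ᶠ k in atTop, x ∈ G k}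
      (l := atTop) (fun n => ENNReal.ofReal (2 * (C * q ^ n) ^ (1 / t))) ?_
      (fun n i => Metric.closedBall i.2.1.1 i.2.1.2) ?_ ?_
    · refine le_antisymm (hle.trans ?_) bot_le
      have hb : ∀ n : ℕ, ∑' i : (Σ k : ℕ, {c // c ∈ U (n + k)}),
          Metric.ediam (Metric.closedBall i.2.1.1 i.2.1.2) ^ t ≤
          ENNReal.ofReal (2 ^ t * C / (1 - q) * q ^ n) := by
        intro n
        rw [ENNReal.tsum_sigma']
        have h1 : ∀ k, ∑' c : {c // c ∈ U (n + k)},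
            Metric.ediam (Metric.closedBall c.1.1 c.1.2) ^ t ≤
            ENNReal.ofReal (2 ^ t * C * q ^ n * q ^ k) := by
          intro k
          rw [tsum_fintype, Finset.sum_coe_sort (U (n + k))
            (fun c => Metric.ediam (Metric.closedBall c.1 c.2) ^ t)]
          calc _ ≤ ∑ c ∈ U (n + k), ENNReal.ofReal ((2 * c.2) ^ t) := by
                refine Finset.sum_le_sum fun c hc => ?_
                rw [← ENNReal.ofReal_rpow_of_nonneg (by have := hU0 _ c hc; positivity) ht.le]
                exact ENNReal.rpow_le_rpow (hdiam c) ht.le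
            _ = ENNReal.ofReal (∑ c ∈ U (n + k), (2 * c.2) ^ t) :=
                (ENNReal.ofReal_sum_of_nonneg fun c hc =>
                  Real.rpow_nonneg (by have := hU0 _ c hc; positivity) _).symm
            _ ≤ _ := by
                refine ENNReal.ofReal_le_ofReal ?_
                rw [Finset.sum_congr rfl fun c hc =>
                  Real.mul_rpow (by norm_num : (0 : ℝ) ≤ 2) (hU0 _ c hc), ← Finset.mul_sum]
                calc _ ≤ 2 ^ t * (C * q ^ (n + k)) := by gcongr; exact hUs _
                  _ = _ := by rw [pow_add]; ring
        refine (ENNReal.tsum_le_tsum h1).trans ?_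
        have hgeo : HasSum (fun k : ℕ => 2 ^ t * C * q ^ n * q ^ k)
            (2 ^ t * C * q ^ n * (1 - q)⁻¹) := (hasSum_geometric_of_lt_one hq0 hq1).mul_left _
        rw [← ENNReal.ofReal_tsum_of_nonneg (fun k => by positivity) hgeo.summable, hgeo.tsum_eq]
        refine ENNReal.ofReal_le_ofReal (le_of_eq ?_)
        rw [div_eq_mul_inv]; ring
      have hlim : Tendsto (fun n : ℕ => ENNReal.ofReal (2 ^ t * C / (1 - q) * q ^ n)) atTop
          (𝓝 0) := by
        have := ENNReal.tendsto_ofReal (hpow.const_mul (2 ^ t * C / (1 - q)))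
        simpa using this
      rw [← hlim.liminf_eq]
      exact liminf_le_liminf (Eventually.of_forall hb)
    · have h1 : Tendsto (fun n : ℕ => (C * q ^ n) ^ (1 / t)) atTop (𝓝 0) := by
        have h2 : Tendsto (fun n : ℕ => C * q ^ n) atTop (𝓝 0) := by
          simpa using hpow.const_mul C
        have h3 := h2.rpow_const (p := 1 / t) (Or.inr (by positivity))
        rwa [Real.zero_rpow (by positivity)] at h3
      have := ENNReal.tendsto_ofReal (h1.const_mul 2)
      simpa using this
    · refine Eventually.of_forall fun n i => (hdiam _).trans (ENNReal.ofReal_le_ofReal ?_)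
      obtain ⟨k, c, hc⟩ := i
      have hc0 := hU0 _ c hc
      have h1 : c.2 ^ t ≤ C * q ^ n :=
        calc c.2 ^ t ≤ ∑ c ∈ U (n + k), c.2 ^ t :=
              Finset.single_le_sum (f := fun c : X × ℝ => c.2 ^ t)
                (fun d hd => Real.rpow_nonneg (hU0 _ d hd) _) hc
          _ ≤ C * q ^ (n + k) := hUs _
          _ ≤ C * q ^ n := by
            gcongr C * ?_
            exact pow_le_pow_of_le_one hq0 hq1.le (by omega)
      have h2 : c.2 ≤ (C * q ^ n) ^ (1 / t) := by
        have := Real.rpow_le_rpow (Real.rpow_nonneg hc0 _) h1 (by positivity : 0 ≤ 1 / t)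
        rwa [← Real.rpow_mul hc0, mul_one_div_cancel ht.ne', Real.rpow_one] at this
      simp only
      linarith
    · refine Eventually.of_forall fun n x hx => ?_
      obtain ⟨k, hk, hxk⟩ := (frequently_atTop.1 hx) n
      obtain ⟨j, rfl⟩ := Nat.exists_eq_add_of_le hk
      obtain ⟨c, hc, hxc⟩ := Set.mem_iUnion₂.1 (hUc _ hxk)
      exact Set.mem_iUnion.2 ⟨⟨j, c, hc⟩, hxc⟩
  refine dimH_le_of_hausdorffMeasure_ne_top (d := t.toNNReal) ?_
  rw [Real.coe_toNNReal t ht.le, hμ]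
  exact ENNReal.zero_ne_top

/-! ### Kernels, energies and capacities. -/

section Kernel

variable {n : ℕ} {s r : ℝ}

theorem profileKernel_of_ne {x : RSpace n} (hx : x ≠ 0) :
    profileKernel s r x = min 1 ((r / ‖x‖) ^ s) := by
  rw [profileKernel, if_neg hx]

theorem profileKernel_zero : profileKernel s r (0 : RSpace n) = 1 := by
  rw [profileKernel, if_pos rfl]

theorem profileKernel_nonneg (hr : 0 ≤ r) (x : RSpace n) : 0 ≤ profileKernel s r x := by
  unfold profileKernel
  split_ifs <;> positivity

theorem profileKernel_le_one (x : RSpace n) : profileKernel s r x ≤ 1 := by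
  unfold profileKernel
  split_ifs
  · exact le_rfl
  · exact min_le_left _ _

theorem measurable_profileKernel : Measurable (profileKernel s r : RSpace n → ℝ) := by
  unfold profileKernel
  exact Measurable.ite (measurableSet_singleton 0) measurable_const (by fun_prop)

theorem le_profileKernel {D : ℝ} (hs : 0 ≤ s) (hr : 0 ≤ r) {x : RSpace n} (hx : ‖x‖ ≤ D) :
    min 1 ((r / D) ^ s) ≤ profileKernel s r x := by
  rcases eq_or_ne x 0 with rfl | h
  · rw [profileKernel_zero]; exact min_le_left _ _
  · rw [profileKernel_of_ne h]
    have := norm_pos_iff.2 h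
    have : 0 < D := this.trans_le hx
    gcongr

/-- Together with its consequence for capacities, this permits replacing an arbitrary scale by a
dyadic one at the cost of `2 ^ s`. -/
theorem profileKernel_le_two_rpow_mul {R : ℝ} (hs : 0 ≤ s) (hr : 0 ≤ r) (hR0 : 0 ≤ R)
    (hR : R ≤ 2 * r) (x : RSpace n) :
    profileKernel s R x ≤ 2 ^ s * profileKernel s r x := by
  have h2 : (1 : ℝ) ≤ 2 ^ s := Real.one_le_rpow (by norm_num) hs
  rcases eq_or_ne x 0 with rfl | h
  · simpa [profileKernel_zero] using h2
  · rw [profileKernel_of_ne h, profileKernel_of_ne h, mul_min_of_nonneg _ _ (by positivity),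
      mul_one, ← Real.mul_rpow (by norm_num) (by positivity)]
    refine min_le_min h2 (Real.rpow_le_rpow (by positivity) ?_ hs)
    rw [← mul_div_assoc]
    gcongr

theorem integrable_profileKernel_sub (hr : 0 ≤ r) (μ : Measure (RSpace n))
    [IsProbabilityMeasure μ] :
    Integrable (fun q : RSpace n × RSpace n => profileKernel s r (q.2 - q.1)) (μ.prod μ) := by
  refine Integrable.of_bound
    (measurable_profileKernel.comp (by fun_prop : Measurable fun q : RSpace n × RSpace n =>
      q.2 - q.1)).aestronglyMeasurable 1 (Eventually.of_forall fun q => ?_)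
  rw [Real.norm_of_nonneg (profileKernel_nonneg hr _)]
  exact profileKernel_le_one _

theorem kernelEnergy_eq (hr : 0 ≤ r) (μ : Measure (RSpace n)) [IsProbabilityMeasure μ] :
    kernelEnergy s r μ = ∫ q : RSpace n × RSpace n, profileKernel s r (q.2 - q.1) ∂(μ.prod μ) := by
  rw [integral_prod _ (integrable_profileKernel_sub hr μ)]
  rfl

theorem ae_prod_mem {μ : Measure (RSpace n)} [IsProbabilityMeasure μ] {E : Set (RSpace n)}
    (hμ : μ Eᶜ = 0) : ∀ᵐ q ∂(μ.prod μ), q.1 ∈ E ∧ q.2 ∈ E := by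
  have h : ∀ᵐ x ∂μ, x ∈ E := hμ
  exact (Measure.quasiMeasurePreserving_fst.ae h).and (Measure.quasiMeasurePreserving_snd.ae h)

theorem le_kernelEnergy {D : ℝ} (hs : 0 ≤ s) (hr : 0 ≤ r) {E : Set (RSpace n)}
    (hD : ∀ x ∈ E, ∀ y ∈ E, ‖x - y‖ ≤ D) {μ : Measure (RSpace n)} [IsProbabilityMeasure μ]
    (hμ : μ Eᶜ = 0) : min 1 ((r / D) ^ s) ≤ kernelEnergy s r μ := by
  rw [kernelEnergy_eq hr]
  calc min 1 ((r / D) ^ s) = ∫ _q : RSpace n × RSpace n, min 1 ((r / D) ^ s) ∂(μ.prod μ) := by simp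
    _ ≤ _ := by
      refine integral_mono_ae (integrable_const _) (integrable_profileKernel_sub hr μ) ?_
      filter_upwards [ae_prod_mem hμ] with q hq
      exact le_profileKernel hs hr (hD _ hq.2 _ hq.1)

theorem energiesOn_nonempty {E : Set (RSpace n)} (hE : IsCompact E) (hne : E.Nonempty) :
    (energiesOn s r E).Nonempty := by
  obtain ⟨x, hx⟩ := hne
  refine ⟨_, Measure.dirac x, inferInstance, ?_, rfl⟩
  rw [Measure.dirac_apply' _ hE.measurableSet.compl]
  simp [hx]

/-- The kernel is bounded below on the bounded set of differences. Positivity keeps the capacity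
away from the default `0⁻¹ = 0` and supplies measures within a factor two of optimal. -/
theorem sInf_energiesOn_pos {D : ℝ} (hD0 : 0 < D) (hs : 0 ≤ s) (hr : 0 < r) {E : Set (RSpace n)}
    (hE : IsCompact E) (hne : E.Nonempty) (hD : ∀ x ∈ E, ∀ y ∈ E, ‖x - y‖ ≤ D) :
    0 < sInf (energiesOn s r E) := by
  have h0 : 0 < min 1 ((r / D) ^ s) := by positivity
  refine h0.trans_le (le_csInf (energiesOn_nonempty hE hne) ?_)
  rintro _ ⟨μ, hμ, hμE, rfl⟩
  exact le_kernelEnergy hs hr.le hD hμE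

theorem kernelEnergy_nonneg (hr : 0 ≤ r) (μ : Measure (RSpace n)) : 0 ≤ kernelEnergy s r μ :=
  integral_nonneg fun _ => integral_nonneg fun _ => profileKernel_nonneg hr _

theorem bddBelow_energiesOn (hr : 0 ≤ r) (E : Set (RSpace n)) : BddBelow (energiesOn s r E) :=
  ⟨0, by rintro _ ⟨μ, -, -, rfl⟩; exact kernelEnergy_nonneg hr μ⟩

theorem kernelCapacity_pos {D : ℝ} (hD0 : 0 < D) (hs : 0 ≤ s) (hr : 0 < r) {E : Set (RSpace n)}
    (hE : IsCompact E) (hne : E.Nonempty) (hD : ∀ x ∈ E, ∀ y ∈ E, ‖x - y‖ ≤ D) :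
    0 < kernelCapacity s r E :=
  inv_pos.2 (sInf_energiesOn_pos hD0 hs hr hE hne hD)

theorem exists_kernelEnergy_le {D : ℝ} (hD0 : 0 < D) (hs : 0 ≤ s) (hr : 0 < r)
    {E : Set (RSpace n)} (hE : IsCompact E) (hne : E.Nonempty)
    (hD : ∀ x ∈ E, ∀ y ∈ E, ‖x - y‖ ≤ D) :
    ∃ μ : Measure (RSpace n), IsProbabilityMeasure μ ∧ μ Eᶜ = 0 ∧
      kernelEnergy s r μ * kernelCapacity s r E ≤ 2 := by
  have h0 := sInf_energiesOn_pos hD0 hs hr hE hne hD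
  obtain ⟨_, ⟨μ, hμ, hμE, rfl⟩, h⟩ := exists_lt_of_csInf_lt (energiesOn_nonempty hE hne)
    (show sInf (energiesOn s r E) < 2 * sInf (energiesOn s r E) by linarith)
  refine ⟨μ, hμ, hμE, ?_⟩
  rw [kernelCapacity, ← div_eq_mul_inv, div_le_iff₀ h0]
  exact h.le

theorem kernelCapacity_le_two_rpow_mul {D R : ℝ} (hD0 : 0 < D) (hs : 0 ≤ s) (hr : 0 < r)
    (hR0 : 0 < R) (hR : R ≤ 2 * r) {E : Set (RSpace n)} (hE : IsCompact E) (hne : E.Nonempty)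
    (hD : ∀ x ∈ E, ∀ y ∈ E, ‖x - y‖ ≤ D) :
    kernelCapacity s r E ≤ 2 ^ s * kernelCapacity s R E := by
  have h1 := sInf_energiesOn_pos hD0 hs hr hE hne hD
  have h2 := sInf_energiesOn_pos hD0 hs hR0 hE hne hD
  have h3 : (0 : ℝ) < 2 ^ s := by positivity
  have h : sInf (energiesOn s R E) / 2 ^ s ≤ sInf (energiesOn s r E) := by
    refine le_csInf (energiesOn_nonempty hE hne) ?_
    rintro _ ⟨μ, hμ, hμE, rfl⟩
    rw [div_le_iff₀ h3]
    refine (csInf_le (bddBelow_energiesOn hR0.le E) ⟨μ, hμ, hμE, rfl⟩).trans ?_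
    rw [kernelEnergy_eq hR0.le, kernelEnergy_eq hr.le, mul_comm, ← integral_const_mul]
    exact integral_mono (integrable_profileKernel_sub hR0.le μ)
      ((integrable_profileKernel_sub hr.le μ).const_mul _)
      fun q => profileKernel_le_two_rpow_mul hs hr.le hR0.le hR _
  unfold kernelCapacity
  rw [← div_eq_mul_inv, inv_le_comm₀ h1 (by positivity), inv_div]
  exact h

end Kernel

/-! ### Covering numbers and Cauchy–Schwarz. -/

section BoxCover

variable {n : ℕ}

/-- Ensures that the `sInf` in `ℕ` is attained by a cover, rather than being the default `sInf ∅ =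
0`. -/
theorem boxCoverNumber_set_nonempty {r : ℝ} (hr : 0 < r) {F : Set (RSpace n)}
    (hF : Bornology.IsBounded F) :
    {k : ℕ | ∃ U : Fin k → Set (RSpace n),
      (∀ i, Bornology.IsBounded (U i) ∧ Metric.diam (U i) ≤ r) ∧ F ⊆ ⋃ i, U i}.Nonempty := by
  have htb : TotallyBounded F := by
    obtain ⟨R, hR⟩ := hF.subset_closedBall 0
    exact (isCompact_closedBall 0 R).totallyBounded.subset hR
  obtain ⟨T, hT, hFT⟩ := Metric.totallyBounded_iff.1 htb (r / 2) (by positivity)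
  have := hT.fintype
  refine ⟨Fintype.card T, fun i => Metric.ball ((Fintype.equivFin T).symm i : RSpace n) (r / 2),
    fun i => ⟨Metric.isBounded_ball, (Metric.diam_ball (by positivity)).trans (by linarith)⟩, ?_⟩
  intro x hx
  obtain ⟨y, hy, hxy⟩ := Set.mem_iUnion₂.1 (hFT hx)
  exact Set.mem_iUnion.2 ⟨Fintype.equivFin T ⟨y, hy⟩, by simpa using hxy⟩

theorem exists_boxCover {r : ℝ} (hr : 0 < r) {F : Set (RSpace n)} (hF : Bornology.IsBounded F) :
    ∃ U : Fin (boxCoverNumber r F) → Set (RSpace n),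
      (∀ i, Bornology.IsBounded (U i) ∧ Metric.diam (U i) ≤ r) ∧ F ⊆ ⋃ i, U i :=
  Nat.sInf_mem (boxCoverNumber_set_nonempty hr hF)

theorem boxCoverNumber_anti {r R : ℝ} (hr : 0 < r) (hrR : r ≤ R) {F : Set (RSpace n)}
    (hF : Bornology.IsBounded F) : boxCoverNumber R F ≤ boxCoverNumber r F := by
  obtain ⟨U, hU, hFU⟩ := exists_boxCover hr hF
  exact Nat.sInf_le ⟨U, fun i => ⟨(hU i).1, (hU i).2.trans hrR⟩, hFU⟩

theorem boxCoverNumber_pos {r : ℝ} (hr : 0 < r) {F : Set (RSpace n)}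
    (hF : Bornology.IsBounded F) (hne : F.Nonempty) : 0 < boxCoverNumber r F := by
  obtain ⟨U, -, hFU⟩ := exists_boxCover hr hF
  obtain ⟨x, hx⟩ := hne
  obtain ⟨i, -⟩ := Set.mem_iUnion.1 (hFU hx)
  exact i.pos

theorem measurableSet_norm_sub_le (L : RSpace n →L[ℝ] RSpace n) (r : ℝ) :
    MeasurableSet {q : RSpace n × RSpace n | ‖L (q.2 - q.1)‖ ≤ r} :=
  (isClosed_le (by fun_prop) continuous_const).measurableSet

/-- A linear image of `E` whose covering number at scale `r` is small forces any probability
measure on `E` to charge the pairs of points with `r`-close images. -/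
theorem one_le_boxCoverNumber_mul {r : ℝ} (hr : 0 < r) (L : RSpace n →L[ℝ] RSpace n)
    {E : Set (RSpace n)} (hE : IsCompact E) {μ : Measure (RSpace n)} [IsProbabilityMeasure μ]
    (hμ : μ Eᶜ = 0) :
    1 ≤ (boxCoverNumber r (L '' E) : ℝ) *
      (μ.prod μ).real {q | ‖L (q.2 - q.1)‖ ≤ r} := by
  have hcover := exists_boxCover hr (hE.image L.continuous).isBounded
  generalize boxCoverNumber r (L '' E) = k at hcover ⊢
  obtain ⟨U, hU, hEU⟩ := hcover
  let A : Fin k → Set (RSpace n) := fun i => L ⁻¹' closure (U i)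
  -- Disjoint measurable cells. Closures give measurability without increasing diameters, so two
  -- points of one cell have images within `r`.
  let B : Fin k → Set (RSpace n) := fun i => A i \ ⋃ j : {j // j < i}, A j
  have hA : ∀ i, MeasurableSet (A i) := fun i => (isClosed_closure.preimage L.continuous).measurableSet
  have hB : ∀ i, MeasurableSet (B i) := fun i =>
    (hA i).diff (MeasurableSet.iUnion fun j => hA j)
  have hdis : Pairwise (Function.onFun Disjoint B) := by
    have h : ∀ i j, i < j → Disjoint (B i) (B j) := fun i j hij =>
      Set.disjoint_left.2 fun x hi hj => hj.2 (Set.mem_iUnion.2 ⟨⟨i, hij⟩, hi.1⟩)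
    intro i j hij
    rcases lt_or_gt_of_ne hij with h1 | h1
    · exact h i j h1
    · exact (h j i h1).symm
  have hEB : E ⊆ ⋃ i, B i := by
    classical
    intro x hx
    obtain ⟨i, hi⟩ := Set.mem_iUnion.1 (hEU ⟨x, hx, rfl⟩)
    have hne : (Finset.univ.filter fun i => x ∈ A i).Nonempty :=
      ⟨i, Finset.mem_filter.2 ⟨Finset.mem_univ _, subset_closure hi⟩⟩
    have hmin := Finset.min'_mem _ hne
    refine Set.mem_iUnion.2 ⟨_, (Finset.mem_filter.1 hmin).2, fun h => ?_⟩
    obtain ⟨⟨j, hj⟩, hxj⟩ := Set.mem_iUnion.1 h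
    exact absurd (Finset.min'_le _ j (Finset.mem_filter.2 ⟨Finset.mem_univ _, hxj⟩))
      (not_le.2 hj)
  have hone : 1 ≤ ∑ i, μ.real (B i) := by
    have h1 : μ.real (⋃ i, B i) = 1 := by
      rw [measureReal_def, (prob_compl_eq_zero_iff (MeasurableSet.iUnion hB)).1
        (measure_mono_null (Set.compl_subset_compl.2 hEB) hμ), ENNReal.toReal_one]
    rw [← h1]
    exact measureReal_iUnion_fintype_le _
  have hsq : ∑ i, μ.real (B i) ^ 2 ≤ (μ.prod μ).real {q | ‖L (q.2 - q.1)‖ ≤ r} := by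
    have h1 : ∀ i, μ.real (B i) ^ 2 = (μ.prod μ).real (B i ×ˢ B i) := fun i => by
      rw [measureReal_prod_prod, sq]
    simp only [h1]
    rw [← measureReal_iUnion_fintype (fun i j hij => Set.disjoint_prod.2 (Or.inl (hdis hij)))
      (fun i => (hB i).prod (hB i))]
    refine measureReal_mono (Set.iUnion_subset fun i q hq => ?_)
    have h2 := Metric.dist_le_diam_of_mem (hU i).1.closure hq.2.1 hq.1.1
    rw [Metric.diam_closure, dist_eq_norm, ← map_sub] at h2
    exact h2.trans (hU i).2
  have hcs := sq_sum_le_card_mul_sum_sq (s := Finset.univ) (f := fun i => μ.real (B i))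
  rw [Finset.card_univ, Fintype.card_fin] at hcs
  calc (1 : ℝ) ≤ (∑ i, μ.real (B i)) ^ 2 := one_le_pow₀ hone
    _ ≤ _ := hcs
    _ ≤ _ := by gcongr

end BoxCover

/-! ### Weights on the Grassmannian against the kernel. -/

namespace GrassmannSpace

variable {n m : ℕ}

theorem dist_le_two (V W : GrassmannSpace n m) : dist V W ≤ 2 := by
  have h : dist V W = ‖V.space.starProjection - W.space.starProjection‖ :=
    dist_eq_norm V.proj W.proj
  rw [h]
  have h1 := V.space.starProjection_norm_le
  have h2 := W.space.starProjection_norm_le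
  exact (norm_sub_le _ _).trans (by linarith)

theorem totallyBounded (G : Set (GrassmannSpace n m)) : TotallyBounded G := by
  have hiso : Isometry (proj : GrassmannSpace n m → _) := fun _ _ => rfl
  rw [← totallyBounded_image_iff hiso.isUniformInducing]
  refine (isCompact_closedBall (0 : RSpace n →L[ℝ] RSpace n) 1).totallyBounded.subset ?_
  rintro _ ⟨V, -, rfl⟩
  rw [mem_closedBall_zero_iff]
  exact V.space.starProjection_norm_le

/-- For weights on the Grassmannian with `t`-dimensional growth, the mass of the planes onto which
`z` projects to a vector of length at most `r` is controlled by the kernel `φ_r^s(z)`. -/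
theorem sum_indicator_le (hmn : m < n) {s t D : ℝ} (hs : 0 ≤ s)
    (ht : (m : ℝ) * ((n : ℝ) - m) - (m - s) ≤ t) (hD : 1 ≤ D) :
    ∃ C : ℝ, 0 < C ∧ ∀ r : ℝ, 0 < r → r ≤ 1 → ∀ (P : Finset (GrassmannSpace n m))
      (w : GrassmannSpace n m → ℝ), (∀ p, 0 ≤ w p) →
      (∀ p ∈ P, ∀ l : ℝ, r ≤ l → ∑ q ∈ P, (Metric.closedBall p l).indicator w q ≤ (2 * l) ^ t) →
      ∀ z : RSpace n, ‖z‖ ≤ D →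
        ∑ p ∈ P, {V : GrassmannSpace n m | ‖V.proj z‖ ≤ r}.indicator w p ≤
          C * profileKernel s r z := by
  classical
  obtain ⟨C₁, hC₁, hcells⟩ := exists_cells n m hmn
  refine ⟨max (4 ^ t * 2 ^ s) (C₁ * (2 * (C₁ * D)) ^ t), by positivity, ?_⟩
  intro r hr hr1 P w hw hball z hz
  -- For `‖z‖ ≤ 2 * r` the kernel is at least `2 ^ (-s)`, and the total mass, that of a ball of
  -- radius `2`, suffices. Otherwise `ρ ≤ 1 / 2` and the cells apply.
  rcases le_or_gt ‖z‖ (2 * r) with hzr | hzr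
  · have htot : ∑ p ∈ P, {V : GrassmannSpace n m | ‖V.proj z‖ ≤ r}.indicator w p ≤ 4 ^ t := by
      rcases P.eq_empty_or_nonempty with rfl | ⟨p, hp⟩
      · simp; positivity
      · have h := hball p hp 2 (by linarith)
        norm_num at h
        refine le_trans (Finset.sum_le_sum fun q _ => ?_) h
        exact Set.indicator_le_indicator_of_subset (fun q _ => dist_le_two _ _) (fun q => hw q) q
    have hφ : 1 ≤ 2 ^ s * profileKernel s r z := by
      have h2 : (1 : ℝ) ≤ 2 ^ s := Real.one_le_rpow (by norm_num) hs
      rcases eq_or_ne z 0 with rfl | h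
      · simpa [profileKernel_zero] using h2
      · have h0 := norm_pos_iff.2 h
        rw [profileKernel_of_ne h, mul_min_of_nonneg _ _ (by positivity), mul_one,
          ← Real.mul_rpow (by norm_num) (by positivity)]
        refine le_min h2 (Real.one_le_rpow ?_ hs)
        rw [← mul_div_assoc, le_div_iff₀ h0]
        linarith
    calc _ ≤ (4 : ℝ) ^ t * 1 := by rw [mul_one]; exact htot
      _ ≤ 4 ^ t * (2 ^ s * profileKernel s r z) := by gcongr
      _ = (4 ^ t * 2 ^ s) * profileKernel s r z := by ring
      _ ≤ _ := by
        gcongr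
        · exact profileKernel_nonneg hr.le z
        · exact le_max_left _ _
  · have hz0 : 0 < ‖z‖ := by linarith
    have hzne : z ≠ 0 := norm_pos_iff.1 hz0
    set ρ := r / ‖z‖ with hρ
    have hρ0 : 0 < ρ := by positivity
    have hρ2 : ρ ≤ 1 / 2 := by rw [hρ, div_le_iff₀ hz0]; linarith
    obtain ⟨T, F, c, hFc, hcF, hdist⟩ := hcells (‖z‖⁻¹ • z)
      (by rw [norm_smul, norm_inv, norm_norm, inv_mul_cancel₀ hz0.ne']) ρ hρ0 hρ2
    have hsmall : ∀ V : GrassmannSpace n m, ‖V.proj z‖ ≤ r → ‖V.proj (‖z‖⁻¹ • z)‖ ≤ ρ := by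
      intro V hV
      rw [map_smul, norm_smul, norm_inv, norm_norm, hρ, div_eq_inv_mul]
      gcongr
    have hφ : profileKernel s r z = ρ ^ s := by
      rw [profileKernel_of_ne hzne, ← hρ]
      exact min_eq_right (Real.rpow_le_one hρ0.le (by linarith) hs)
    let Q := P.filter fun V : GrassmannSpace n m => ‖V.proj z‖ ≤ r
    have hQ : ∀ p ∈ Q, ‖p.proj z‖ ≤ r := fun p hp => (Finset.mem_filter.1 hp).2
    have hsum : ∑ p ∈ P, {V : GrassmannSpace n m | ‖V.proj z‖ ≤ r}.indicator w p
        = ∑ p ∈ Q, w p := by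
      rw [Finset.sum_filter]
      exact Finset.sum_congr rfl fun p _ => by simp [Set.indicator_apply]
    have hcell : ∀ y ∈ F, ∑ p ∈ Q with c p = y, w p ≤ (2 * (C₁ * D * ρ)) ^ t := by
      intro y _
      rcases (Q.filter fun p => c p = y).eq_empty_or_nonempty with h | ⟨p₀, hp₀⟩
      · rw [h, Finset.sum_empty]; positivity
      · obtain ⟨hp₀Q, hp₀y⟩ := Finset.mem_filter.1 hp₀
        -- The growth condition holds only at radii at least `r`; the factor `D ≥ ‖z‖` brings the
        -- cell radius up to that range.
        have hl : r ≤ C₁ * D * ρ := by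
          have h1 : r ≤ D * ρ := by
            rw [hρ, ← mul_div_assoc, le_div_iff₀ hz0, mul_comm]
            gcongr
          calc r ≤ 1 * (D * ρ) := by rwa [one_mul]
            _ ≤ C₁ * (D * ρ) := by gcongr
            _ = _ := by ring
        refine le_trans ?_ (hball p₀ (Finset.mem_filter.1 hp₀Q).1 _ hl)
        calc ∑ p ∈ Q with c p = y, w p
            = ∑ p ∈ Q with c p = y, (Metric.closedBall p₀ (C₁ * D * ρ)).indicator w p := by
              refine Finset.sum_congr rfl fun p hp => ?_
              obtain ⟨hpQ, hpy⟩ := Finset.mem_filter.1 hp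
              rw [Set.indicator_of_mem]
              refine Metric.mem_closedBall.2 ((hdist p p₀ (hsmall _ (hQ p hpQ))
                (hsmall _ (hQ p₀ hp₀Q)) (hpy.trans hp₀y.symm)).trans ?_)
              gcongr
              nlinarith
          _ ≤ _ := Finset.sum_le_sum_of_subset_of_nonneg
              ((Finset.filter_subset _ _).trans (Finset.filter_subset _ _))
              fun p _ _ => Set.indicator_nonneg (fun q _ => hw q) p
    have hmul : (1 / ρ) ^ (m * (n - 1 - m)) * ρ ^ t ≤ ρ ^ s := by
      rw [one_div, inv_pow, ← Real.rpow_natCast, ← Real.rpow_neg hρ0.le, ← Real.rpow_add hρ0]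
      refine Real.rpow_le_rpow_of_exponent_ge hρ0 (by linarith) ?_
      have : ((m * (n - 1 - m) : ℕ) : ℝ) = m * ((n : ℝ) - 1 - m) := by
        rw [Nat.cast_mul, Nat.cast_sub (by omega), Nat.cast_sub (by omega), Nat.cast_one]
      rw [this]
      linarith
    rw [hsum, hφ, ← Finset.sum_fiberwise_of_maps_to (fun p hp => hcF p (hsmall p (hQ p hp)))]
    calc _ ≤ ∑ _y ∈ F, (2 * (C₁ * D * ρ)) ^ t := Finset.sum_le_sum hcell
      _ = F.card * ((2 * (C₁ * D)) ^ t * ρ ^ t) := by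
        rw [Finset.sum_const, nsmul_eq_mul, ← Real.mul_rpow (by positivity) hρ0.le]
        ring_nf
      _ ≤ (C₁ * (1 / ρ) ^ (m * (n - 1 - m))) * ((2 * (C₁ * D)) ^ t * ρ ^ t) := by gcongr
      _ = (C₁ * (2 * (C₁ * D)) ^ t) * ((1 / ρ) ^ (m * (n - 1 - m)) * ρ ^ t) := by ring
      _ ≤ (C₁ * (2 * (C₁ * D)) ^ t) * ρ ^ s := by gcongr
      _ ≤ _ := by
        gcongr
        exact le_max_right _ _

end GrassmannSpace

/-! ### Exceptional planes at one scale and at infinitely many. -/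

namespace GrassmannSpace

variable {n m : ℕ}

/-- The planes onto which `E` projects to a set with few boxes at scale `2 ^ (-k)`, compared to the
capacity of `E`, have a covering by balls with small `t`-sum. -/
theorem exists_cover_of_few_boxes (hmn : m < n) {E : Set (RSpace n)} (hE : IsCompact E)
    (hne : E.Nonempty) {s t q : ℝ} (hs : 0 ≤ s) (ht0 : 0 ≤ t) (hq : 0 ≤ q)
    (ht : (m : ℝ) * ((n : ℝ) - m) - (m - s) ≤ t) :
    ∃ C : ℝ, 0 ≤ C ∧ ∀ k : ℕ, ∃ U : Finset (GrassmannSpace n m × ℝ), (∀ c ∈ U, 0 ≤ c.2) ∧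
      ∑ c ∈ U, c.2 ^ t ≤ C * q ^ k ∧
      {V : GrassmannSpace n m | (boxCoverNumber ((1 / 2) ^ k) (V.proj '' E) : ℝ) ≤
        2 ^ s * (q ^ k * kernelCapacity s ((1 / 2) ^ k) E)} ⊆
        ⋃ c ∈ U, Metric.closedBall c.1 c.2 := by
  classical
  obtain ⟨D, hD1, hD⟩ : ∃ D : ℝ, 1 ≤ D ∧ ∀ x ∈ E, ∀ y ∈ E, ‖x - y‖ ≤ D :=
    ⟨max 1 (Metric.diam E), le_max_left _ _, fun x hx y hy => by
      rw [← dist_eq_norm]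
      exact (Metric.dist_le_diam_of_mem hE.isBounded hx hy).trans (le_max_right _ _)⟩
  obtain ⟨C, hC, hCP⟩ := sum_indicator_le hmn hs ht hD1
  refine ⟨6 ^ t * (2 ^ s * (C * 2)), by positivity, fun k => ?_⟩
  set r : ℝ := (1 / 2) ^ k with hr
  set G := {V : GrassmannSpace n m | (boxCoverNumber r (V.proj '' E) : ℝ) ≤
        2 ^ s * (q ^ k * kernelCapacity s r E)} with hG
  have hr0 : 0 < r := by positivity
  have hr1 : r ≤ 1 := pow_le_one₀ (by norm_num) (by norm_num)
  have hcap := kernelCapacity_pos (by linarith) hs hr0 hE hne hD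
  obtain ⟨μ, hμ, hμE, hμC⟩ := exists_kernelEnergy_le (by linarith) hs hr0 hE hne hD
  obtain ⟨P, hPG, hPfin, hGP⟩ := (totallyBounded G).exists_subset
    (Metric.dist_mem_uniformity hr0)
  lift P to Finset (GrassmannSpace n m) using hPfin
  obtain ⟨w, hw, hball, U, hUr, hUs, hUP⟩ := exists_frostman_weights P k ht0 dist_le_two
  let M : GrassmannSpace n m → ℝ := fun p => (μ.prod μ).real {x | ‖p.proj (x.2 - x.1)‖ ≤ r}
  have hM : ∑ p ∈ P, w p * M p ≤ C * kernelEnergy s r μ := by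
    have h1 : ∀ p : GrassmannSpace n m, w p * M p = ∫ x : RSpace n × RSpace n,
        {V : GrassmannSpace n m | ‖V.proj (x.2 - x.1)‖ ≤ r}.indicator w p ∂(μ.prod μ) := by
      intro p
      have h2 : (fun x : RSpace n × RSpace n =>
          {V : GrassmannSpace n m | ‖V.proj (x.2 - x.1)‖ ≤ r}.indicator w p) =
          {x : RSpace n × RSpace n | ‖p.proj (x.2 - x.1)‖ ≤ r}.indicator fun _ => w p := by
        funext x
        simp [Set.indicator_apply]
      rw [h2, integral_indicator_const _ (measurableSet_norm_sub_le p.proj r), smul_eq_mul, mul_comm]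
    have hint : ∀ p : GrassmannSpace n m, Integrable (fun x : RSpace n × RSpace n =>
        {V : GrassmannSpace n m | ‖V.proj (x.2 - x.1)‖ ≤ r}.indicator w p) (μ.prod μ) := by
      intro p
      have h2 : (fun x : RSpace n × RSpace n =>
          {V : GrassmannSpace n m | ‖V.proj (x.2 - x.1)‖ ≤ r}.indicator w p) =
          {x : RSpace n × RSpace n | ‖p.proj (x.2 - x.1)‖ ≤ r}.indicator fun _ => w p := by
        funext x
        simp [Set.indicator_apply]
      rw [h2]
      exact (integrable_const _).indicator (measurableSet_norm_sub_le p.proj r)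
    simp only [h1]
    rw [← integral_finsetSum _ (fun p _ => hint p), kernelEnergy_eq hr0.le, ← integral_const_mul]
    refine integral_mono_ae (integrable_finsetSum _ fun p _ => hint p)
      ((integrable_profileKernel_sub hr0.le μ).const_mul _) ?_
    filter_upwards [ae_prod_mem hμE] with x hx
    exact hCP r hr0 hr1 P w hw hball _ (hD _ hx.2 _ hx.1)
  have hw_sum : ∑ p ∈ P, w p ≤ (2 ^ s * (C * 2)) * q ^ k := by
    -- The net lies inside `G`, so every `p` has few boxes and `M p` is correspondingly large.
    calc ∑ p ∈ P, w p ≤ ∑ p ∈ P, (2 ^ s * (q ^ k * kernelCapacity s r E)) * (w p * M p) := by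
          refine Finset.sum_le_sum fun p hp => ?_
          have h1 := one_le_boxCoverNumber_mul hr0 p.proj hE hμE
          have h2 : (boxCoverNumber r (p.proj '' E) : ℝ) ≤ _ := hPG hp
          have h3 : 0 ≤ M p := measureReal_nonneg
          calc w p = w p * 1 := (mul_one _).symm
            _ ≤ w p * ((2 ^ s * (q ^ k * kernelCapacity s r E)) * M p) :=
              mul_le_mul_of_nonneg_left (h1.trans (mul_le_mul_of_nonneg_right h2 h3)) (hw p)
            _ = _ := by ring
      _ = (2 ^ s * (q ^ k * kernelCapacity s r E)) * ∑ p ∈ P, w p * M p :=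
          (Finset.mul_sum _ _ _).symm
      _ ≤ (2 ^ s * (q ^ k * kernelCapacity s r E)) * (C * kernelEnergy s r μ) := by gcongr
      _ = (2 ^ s * C * q ^ k) * (kernelEnergy s r μ * kernelCapacity s r E) := by ring
      _ ≤ (2 ^ s * C * q ^ k) * 2 := by gcongr
      _ = _ := by ring
  -- Five from the Vitali enlargement plus one for the `r`-net, as every radius is at least `r`.
  refine ⟨U.image fun c => (c.1, 6 * c.2), ?_, ?_, ?_⟩
  · intro c hc
    obtain ⟨d, hd, rfl⟩ := Finset.mem_image.1 hc
    have := hr0.le.trans (hUr d hd)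
    positivity
  · rw [Finset.sum_image (fun c _ d _ h => by
      simp only [Prod.mk.injEq, mul_eq_mul_left_iff] at h
      exact Prod.ext h.1 (h.2.resolve_right (by norm_num)))]
    calc ∑ c ∈ U, (6 * c.2) ^ t = 6 ^ t * ∑ c ∈ U, c.2 ^ t := by
          rw [Finset.mul_sum]
          exact Finset.sum_congr rfl fun c hc =>
            Real.mul_rpow (by norm_num) (hr0.le.trans (hUr c hc))
      _ ≤ 6 ^ t * ((2 ^ s * (C * 2)) * q ^ k) := by
          gcongr
          exact hUs.trans hw_sum
      _ = _ := by ring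
  · intro V hV
    obtain ⟨p, hp, hVp⟩ := Set.mem_iUnion₂.1 (hGP hV)
    obtain ⟨c, hc, hpc⟩ := hUP p hp
    refine Set.mem_iUnion₂.2 ⟨_, Finset.mem_image_of_mem _ hc, ?_⟩
    have h1 : dist V p < r := hVp
    have h2 := Metric.mem_closedBall.1 hpc
    have h3 := hUr c hc
    refine Metric.mem_closedBall.2 ((dist_triangle V p c.1).trans ?_)
    simp only
    linarith

/-- The planes for which the covering numbers of the projection of `E` are, at arbitrarily small
scales `r`, smaller than the capacity of `E` by a factor `r ^ ε`, form a set of dimension at most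
`m (n - m) - (m - s)`. -/
theorem dimH_frequently_few_boxes_le (hmn : m < n) {E : Set (RSpace n)} (hE : IsCompact E)
    (hne : E.Nonempty) {s ε : ℝ} (hs : 0 ≤ s) (hε : 0 < ε) :
    dimH {V : GrassmannSpace n m | ∃ᶠ r : ℝ in 𝓝[>] 0,
        (boxCoverNumber r (V.proj '' E) : ℝ) ≤ r ^ ε * kernelCapacity s r E} ≤
      ENNReal.ofReal ((m : ℝ) * ((n : ℝ) - m) - (m - s)) := by
  have ht0 : 0 ≤ (m : ℝ) * ((n : ℝ) - m) - (m - s) := by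
    have h1 : (m : ℝ) + 1 ≤ n := by exact_mod_cast hmn
    have h2 : (0 : ℝ) ≤ m := Nat.cast_nonneg m
    nlinarith
  obtain ⟨D, hD1, hD⟩ : ∃ D : ℝ, 1 ≤ D ∧ ∀ x ∈ E, ∀ y ∈ E, ‖x - y‖ ≤ D :=
    ⟨max 1 (Metric.diam E), le_max_left _ _, fun x hx y hy => by
      rw [← dist_eq_norm]
      exact (Metric.dist_le_diam_of_mem hE.isBounded hx hy).trans (le_max_right _ _)⟩
  set q : ℝ := (1 / 2) ^ ε with hq
  have hq0 : 0 ≤ q := by positivity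
  have hq1 : q < 1 := Real.rpow_lt_one (by norm_num) (by norm_num) hε
  let G : ℕ → Set (GrassmannSpace n m) := fun k =>
    {V | (boxCoverNumber ((1 / 2) ^ k) (V.proj '' E) : ℝ) ≤
        2 ^ s * (q ^ k * kernelCapacity s ((1 / 2) ^ k) E)}
  have hsub : {V : GrassmannSpace n m | ∃ᶠ r : ℝ in 𝓝[>] 0,
      (boxCoverNumber r (V.proj '' E) : ℝ) ≤ r ^ ε * kernelCapacity s r E} ⊆
      {V | ∃ᶠ k in atTop, V ∈ G k} := by
    intro V hV
    refine frequently_atTop.2 fun K => ?_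
    have hK : (0 : ℝ) < (1 / 2) ^ K := by positivity
    obtain ⟨r, hr, hr0, hrK⟩ := (hV.and_eventually (Ioo_mem_nhdsGT hK)).exists
    have hK1 : (1 / 2 : ℝ) ^ K ≤ 1 := pow_le_one₀ (by norm_num) (by norm_num)
    obtain ⟨k, hk1, hk2⟩ := exists_nat_pow_near_of_lt_one (x := r) (y := (1 / 2 : ℝ)) hr0
      (by linarith) (by norm_num) (by norm_num)
    refine ⟨k, ?_, ?_⟩
    · have := (pow_lt_pow_iff_right_of_lt_one₀ (by norm_num) (by norm_num)).1 (hk1.trans hrK)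
      omega
    · have hR0 : (0 : ℝ) < (1 / 2) ^ k := by positivity
      have hR2 : (1 / 2 : ℝ) ^ k ≤ 2 * r := by rw [pow_succ] at hk1; linarith
      have hb := boxCoverNumber_anti hr0 hk2 (hE.image V.proj.continuous).isBounded
      have hc := kernelCapacity_le_two_rpow_mul (by linarith) hs hr0 hR0 hR2 hE hne hD
      have hc0 := kernelCapacity_pos (by linarith) hs hr0 hE hne hD
      have hp : r ^ ε ≤ q ^ k := by
        calc r ^ ε ≤ ((1 / 2 : ℝ) ^ k) ^ ε := Real.rpow_le_rpow hr0.le hk2 hε.le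
          _ = q ^ k := by
            rw [hq, ← Real.rpow_natCast, ← Real.rpow_natCast, ← Real.rpow_mul (by norm_num),
              ← Real.rpow_mul (by norm_num), mul_comm]
      calc (boxCoverNumber ((1 / 2) ^ k) (V.proj '' E) : ℝ)
          ≤ boxCoverNumber r (V.proj '' E) := by exact_mod_cast hb
        _ ≤ r ^ ε * kernelCapacity s r E := hr
        _ ≤ q ^ k * (2 ^ s * kernelCapacity s ((1 / 2) ^ k) E) := by gcongr
        _ = _ := by ring
  -- The excess `δ` makes the exponent positive, as the limsup lemma requires; the bound itself
  -- vanishes for `m = n - 1`, `s = 0`.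
  refine ENNReal.le_of_forall_pos_le_add fun δ hδ _ => ?_
  have hδ' : (0 : ℝ) < δ := hδ
  obtain ⟨C, hC, hcov⟩ := exists_cover_of_few_boxes (m := m) hmn hE hne hs
    (t := (m : ℝ) * ((n : ℝ) - m) - (m - s) + δ) (by linarith) hq0 (by linarith)
  calc _ ≤ dimH {V | ∃ᶠ k in atTop, V ∈ G k} := dimH_mono hsub
    _ ≤ ENNReal.ofReal ((m : ℝ) * ((n : ℝ) - m) - (m - s) + δ) :=
      dimH_frequently_le G (by linarith) hC hq0 hq1 hcov
    _ ≤ _ := by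
      refine ENNReal.ofReal_add_le.trans (le_of_eq ?_)
      rw [ENNReal.ofReal_coe_nnreal]

end GrassmannSpace

/-! ### From dimension drops to exceptional scales. -/

/-- A gap between logarithmic growth rates of `N` and `C` at arbitrarily small scales `r` separates
`N` from `C` by a power of `r`. -/
theorem exists_frequently_le_rpow_mul {N C : ℝ → ℝ} (hN : ∀ r, 0 < r → 0 < N r)
    (hC : ∀ r, 0 < r → 0 < C r) {a b : ℚ} (hab : a < b)
    (h : ∃ᶠ r : ℝ in 𝓝[>] 0, ((Real.log (N r) / (-Real.log r) : ℝ) : EReal) < ((a : ℝ) : EReal) ∧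
      ((b : ℝ) : EReal) < ((Real.log (C r) / (-Real.log r) : ℝ) : EReal)) :
    ∃ j : ℕ, ∃ᶠ r : ℝ in 𝓝[>] 0, N r ≤ r ^ (1 / ((j : ℝ) + 1)) * C r := by
  have hab' : (0 : ℝ) < b - a := sub_pos.2 (by exact_mod_cast hab)
  obtain ⟨j, hj⟩ := exists_nat_one_div_lt hab'
  refine ⟨j, (h.and_eventually (Ioo_mem_nhdsGT one_pos)).mono ?_⟩
  rintro r ⟨⟨h1, h2⟩, hr0, hr1⟩
  have hlog : 0 < -Real.log r := neg_pos.2 (Real.log_neg hr0 hr1)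
  rw [EReal.coe_lt_coe_iff, div_lt_iff₀ hlog] at h1
  rw [EReal.coe_lt_coe_iff, lt_div_iff₀ hlog] at h2
  have hCr := hC r hr0
  rw [← Real.log_le_log_iff (hN r hr0) (by positivity),
    Real.log_mul (by positivity) hCr.ne', Real.log_rpow hr0]
  nlinarith

theorem theorem2p9 (n m : ℕ) (hm : 1 ≤ m) (hmn : m < n)
    (E : Set (RSpace n)) (hE : IsCompact E) (hne : E.Nonempty)
    (s : ℝ) (hs0 : 0 ≤ s) (hsm : s ≤ m) :
    dimH {V : GrassmannSpace n m | upperBoxDim (V.proj '' E) < upperBoxProfile s E}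
        ≤ ENNReal.ofReal ((m : ℝ) * ((n : ℝ) - m) - (m - s)) ∧
      dimH {V : GrassmannSpace n m | lowerBoxDim (V.proj '' E) < lowerBoxProfile s E}
        ≤ ENNReal.ofReal ((m : ℝ) * ((n : ℝ) - m) - (m - s)) := by
  let B : ℕ → Set (GrassmannSpace n m) := fun j => {V | ∃ᶠ r : ℝ in 𝓝[>] 0,
    (boxCoverNumber r (V.proj '' E) : ℝ) ≤ r ^ (1 / ((j : ℝ) + 1)) * kernelCapacity s r E}
  have hB : dimH (⋃ j, B j) ≤ ENNReal.ofReal ((m : ℝ) * ((n : ℝ) - m) - (m - s)) := by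
    rw [dimH_iUnion]
    exact iSup_le fun j =>
      GrassmannSpace.dimH_frequently_few_boxes_le hmn hE hne hs0 (by positivity)
  have hN : ∀ (V : GrassmannSpace n m) (r : ℝ), 0 < r →
      (0 : ℝ) < boxCoverNumber r (V.proj '' E) := fun V r hr => by
    exact_mod_cast boxCoverNumber_pos hr (hE.image V.proj.continuous).isBounded (hne.image _)
  have hC : ∀ r : ℝ, 0 < r → 0 < kernelCapacity s r E := fun r hr =>
    kernelCapacity_pos (D := max 1 (Metric.diam E)) (by positivity) hs0 hr hE hne
      fun x hx y hy => by
        rw [← dist_eq_norm]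
        exact (Metric.dist_le_diam_of_mem hE.isBounded hx hy).trans (le_max_right _ _)
  have hbtwn : ∀ x y : EReal, x < y → ∃ a b : ℚ, a < b ∧ x < ((a : ℝ) : EReal) ∧
      ((b : ℝ) : EReal) < y := by
    intro x y hxy
    obtain ⟨a, hxa, hay⟩ := EReal.lt_iff_exists_rat_btwn.1 hxy
    obtain ⟨b, hab, hby⟩ := EReal.lt_iff_exists_rat_btwn.1 hay
    exact ⟨a, b, by exact_mod_cast hab, hxa, hby⟩
  -- Rationals `a < b` separate the two dimensions. For limsups the bound on `N_r` holds eventually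
  -- and that on the capacity frequently; for liminfs the roles swap. Either way both hold at common
  -- arbitrarily small scales.
  refine ⟨(dimH_mono fun V hV => ?_).trans hB, (dimH_mono fun V hV => ?_).trans hB⟩
  · obtain ⟨a, b, hab, ha, hb⟩ := hbtwn _ _ hV
    have h1 := eventually_lt_of_limsup_lt ha
    have h2 := frequently_lt_of_lt_limsup (by isBoundedDefault) hb
    exact Set.mem_iUnion.2 (exists_frequently_le_rpow_mul (hN V) hC hab
      ((h2.and_eventually h1).mono fun _ h => h.symm))
  · obtain ⟨a, b, hab, ha, hb⟩ := hbtwn _ _ hV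
    have h1 := frequently_lt_of_liminf_lt (by isBoundedDefault) ha
    have h2 := eventually_lt_of_lt_liminf hb
    exact Set.mem_iUnion.2 (exists_frequently_le_rpow_mul (hN V) hC hab (h1.and_eventually h2))
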